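/- Definitions. A representation of a set $X$ is a surjective partial map $\delta_X:\subseteq\mathbb N^{\mathbb N}\to X$. A partial function $F:\subseteq\mathbb N^{\mathbb N}\to\mathbb N^{\mathbb N}$ is computable if some computable prefix-monotone function $\varphi$ on finite words over $\mathbb N$ satisfies $F(p)=\sup_{w\sqsubseteq p}\varphi(w)$ for all $p\in\operatorname{dom}(F)$. For a partial multi-valued function $f:\subseteq X\rightrightarrows Y$ between represented spaces, a partial function $F:\subseteq\mathbb N^{\mathbb N}\to\mathbb N^{\mathbb N}$ is a realizer of $f$, written $F\vdash f$, if $\delta_Y(F(p))\in f(\delta_X(p))$ for all $p$ with $\delta_X(p)\in\operatorname{dom}(f)$. One writes $f\le_{\mathrm W}g$ if there are computable $K,H:\subseteq\mathbb N^{\mathbb N}\to\mathbb N^{\mathbb N}$ such that $H\langle\mathrm{id},GK\rangle\vdash f$ for all $G\vdash g$, and $f\le_{\mathrm{sW}}g$ if there are computable $K,H$ such that $HGK\vdash f$ for all $G\vdash g$; here $\langle p,q\rangle(2k)=p(k)$ and $\langle p,q\rangle(2k+1)=q(k)$. Cantor space $2^{\mathbb N}$ is represented by the identity and carries the uniform product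 measure $\mu$ of the fair coin; $[0,1]$ carries its Cauchy representation (by rapidly converging sequences of rationals) and Lebesgue measure. A closed subset $A$ of $X=2^{\mathbb N}$ or $X=[0,1]$ is represented by negative information: a name of $A$ enumerates cylinders $w2^{\mathbb N}$, respectively open rational balls (the empty set being allowed in the list), whose union is $X\setminus A$. For $\varepsilon\in[0,1]$, $\mathsf P_{>\varepsilon}\mathsf C_X$ is the multi-valued function $A\mapsto A$ that maps a closed set $A\subseteq X$ of measure $>\varepsilon$ to an arbitrary point of $A$. Moreover, $\varepsilon\text{-}\mathsf{WWKL}$ is the multi-valued function $T\mapsto[T]$ that maps a binary tree $T\subseteq\{0,1\}^*$, given by its characteristic function and with $\mu([T])>\varepsilon$, to an arbitrary infinite path of $T$, where $[T]\subseteq 2^{\mathbb N}$ is the set of infinite paths of $T$. Theorem. Let $\varepsilon,\delta\in[0,1]$. (1) For $X=2^{\mathbb N}$ and for $X=[0,1]$ the following are equivalent: (a) $\mathsf P_{>\varepsilon}\mathsf C_X\le_{\mathrm W}\mathsf P_{>\delta}\mathsf C_X$; (b) $\mathsf P_{>\varepsilon}\mathsf C_X\le_{\mathrm{sW}}\mathsf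 P_{>\delta}\mathsf C_X$; (c) $\varepsilon\ge\delta$. (2) $\varepsilon\text{-}\mathsf{WWKL}\le_{\mathrm W}\delta\text{-}\mathsf{WWKL}$ if and only if $\varepsilon\ge\delta$. -/

import Mathlib

namespace Weihrauch

open MeasureTheory

/-! ### Computable partial functions on Baire space `ℕ → ℕ` -/

/-- The prefix of length `n` of an infinite sequence. -/
def pre {α : Type*} (p : ℕ → α) (n : ℕ) : List α := (List.range n).map p

/-- A partial function on Baire space is computable if it is computed on its domain by a
prefix-monotone computable function `φ` on finite words: for `p` in the domain of `F` the words
`φ (pre p m)` are prefixes of `F p` of unbounded length. Behaviour outside the domain of `F` is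
not constrained, so restrictions of computable functions are computable. -/
def IsComputable (F : (ℕ → ℕ) →. (ℕ → ℕ)) : Prop :=
  ∃ φ : List ℕ → List ℕ, Computable φ ∧ (∀ u v : List ℕ, u <+: v → φ u <+: φ v) ∧
    ∀ p q : ℕ → ℕ, q ∈ F p →
      (∀ m, φ (pre p m) = pre q (φ (pre p m)).length) ∧
      (∀ n, ∃ m, n ≤ (φ (pre p m)).length)

/-- The pairing `⟨p, q⟩` of sequences: `⟨p, q⟩(2k) = p k` and `⟨p, q⟩(2k+1) = q k`. -/
def pair (p q : ℕ → ℕ) : ℕ → ℕ := fun n => if n % 2 = 0 then p (n / 2) else q (n / 2)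

/-! ### Represented spaces, multi-valued functions, Weihrauch reducibility -/

/-- A representation of `X`, i.e. a surjective partial map from Baire space to `X`, given by its
graph `IsName p x` ("`p` is a name of `x`"). -/
class Represented (X : Type*) where
  IsName : (ℕ → ℕ) → X → Prop
  unique : ∀ {p x y}, IsName p x → IsName p y → x = y
  exists_name : ∀ x, ∃ p, IsName p x

/-- A partial multi-valued function `f : ⊆ X ⇉ Y`. -/
structure MultiFun (X Y : Type*) where
  dom : Set X
  val : X → Set Y

/-- Restriction of a partial multi-valued function to the points of its domain lying in `D`. -/
def MultiFun.restrict {X Y : Type*} (f : MultiFun X Y) (D : Set X) : MultiFun X Y where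
  dom := f.dom ∩ D
  val := f.val

/-- `F` is a realizer of `f`. -/
def Realizes {X Y : Type*} [Represented X] [Represented Y]
    (F : (ℕ → ℕ) →. (ℕ → ℕ)) (f : MultiFun X Y) : Prop :=
  ∀ p x, Represented.IsName p x → x ∈ f.dom →
    ∃ q ∈ F p, ∃ y, Represented.IsName q y ∧ y ∈ f.val x

/-- Weihrauch reducibility `f ≤_W g`: there are computable `K`, `H` such that
`H⟨id, GK⟩` realizes `f` for every realizer `G` of `g`. -/
def LeW {X Y Z W : Type*} [Represented X] [Represented Y] [Represented Z] [Represented W]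
    (f : MultiFun X Y) (g : MultiFun Z W) : Prop :=
  ∃ K H : (ℕ → ℕ) →. (ℕ → ℕ), IsComputable K ∧ IsComputable H ∧
    ∀ G : (ℕ → ℕ) →. (ℕ → ℕ), Realizes G g →
      Realizes (fun p => ((K p).bind G).bind fun q => H (pair p q)) f

/-- Strong Weihrauch reducibility `f ≤_sW g`: there are computable `K`, `H` such that
`HGK` realizes `f` for every realizer `G` of `g`. -/
def LeSW {X Y Z W : Type*} [Represented X] [Represented Y] [Represented Z] [Represented W]
    (f : MultiFun X Y) (g : MultiFun Z W) : Prop :=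
  ∃ K H : (ℕ → ℕ) →. (ℕ → ℕ), IsComputable K ∧ IsComputable H ∧
    ∀ G : (ℕ → ℕ) →. (ℕ → ℕ), Realizes G g →
      Realizes (fun p => ((K p).bind G).bind H) f

/-! ### Closed sets with negative information, closed choice and probabilistic choice -/

/-- A numbered basis of the topology of `X`, containing the empty set. -/
class NumberedBasis (X : Type*) [TopologicalSpace X] where
  basic : ℕ → Set X
  isBasis : TopologicalSpace.IsTopologicalBasis (Set.range basic)
  exists_empty : ∃ n, basic n = ∅

/-- The negative information representation of the closed subsets of `X`: a name of `A` is a list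
of basic open sets whose union is the complement of `A`. -/
instance closedsRepresented (X : Type*) [TopologicalSpace X] [NumberedBasis X] :
    Represented (TopologicalSpace.Closeds X) where
  IsName p A := (A : Set X) = (⋃ i, NumberedBasis.basic (X := X) (p i))ᶜ
  unique h h' := TopologicalSpace.Closeds.ext (h.trans h'.symm)
  exists_name A := by
    obtain ⟨n₀, hn₀⟩ := NumberedBasis.exists_empty (X := X)
    classical
    refine ⟨fun n => if NumberedBasis.basic (X := X) n ⊆ (A : Set X)ᶜ then n else n₀, ?_⟩
    rw [eq_compl_comm]
    ext x
    simp only [Set.mem_iUnion]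
    constructor
    · rintro ⟨i, hi⟩
      split_ifs at hi with h
      · exact h hi
      · simp [hn₀] at hi
    · intro hx
      obtain ⟨_, ⟨i, rfl⟩, hxi, hi⟩ :=
        NumberedBasis.isBasis.exists_subset_of_mem_open hx A.isClosed.isOpen_compl
      exact ⟨i, by rwa [if_pos hi]⟩

/-- Closed choice `C_X : ⊆ 𝒜₋(X) ⇉ X, A ↦ A`, defined on the nonempty closed sets. -/
def closedChoice (X : Type*) [TopologicalSpace X] :
    MultiFun (TopologicalSpace.Closeds X) X where
  dom := {A | (A : Set X).Nonempty}
  val A := A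

/-- Probabilistic choice `P_I C_X`: closed choice restricted to sets of measure in `I`. -/
def probChoice {X : Type*} [TopologicalSpace X] [MeasurableSpace X] (μ : Measure X)
    (I : Set ENNReal) : MultiFun (TopologicalSpace.Closeds X) X :=
  (closedChoice X).restrict {A | μ (A : Set X) ∈ I}

/-! ### Cantor space `2^ℕ = (ℕ → Bool)` -/

/-- The uniform measure on Cantor space: the product of fair coin measures. -/
noncomputable def cantorMeasure : Measure (ℕ → Bool) :=
  Measure.infinitePi fun _ => (PMF.uniformOfFintype Bool).toMeasure

/-- Cantor space is represented by the identity, as a subspace of Baire space. -/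
instance cantorRepresented : Represented (ℕ → Bool) where
  IsName p x := ∀ n, p n = (x n).toNat
  unique {p x y} h h' := funext fun n => by
    have := (h n).symm.trans (h' n)
    revert this
    cases x n <;> cases y n <;> simp
  exists_name x := ⟨fun n => (x n).toNat, fun _ => rfl⟩

/-- The cylinder `w 2^ℕ`. -/
def cylinder (w : List Bool) : Set (ℕ → Bool) := {x | pre x w.length = w}

theorem isOpen_cylinder (w : List Bool) : IsOpen (cylinder w) := by
  have h : cylinder w = (fun x : ℕ → Bool => fun i : Fin w.length => x i) ⁻¹' {fun i => w[i]} := by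
    ext x
    simp only [cylinder, pre, Set.mem_ofPred_eq, Set.mem_preimage, Set.mem_singleton_iff]
    constructor
    · intro hx
      funext i
      have := congrArg (fun l : List Bool => l[(i : ℕ)]?) hx
      simpa using this
    · intro hx
      refine List.ext_getElem (by simp) fun i h1 h2 => ?_
      simpa using congrFun hx ⟨i, h2⟩
  rw [h]
  exact (isOpen_discrete _).preimage (by fun_prop)

/-- The basis of Cantor space: the number `n` stands for the cylinder of the word coded by `n`,
and for the empty set if `n` is not the code of a word. -/
instance cantorBasis : NumberedBasis (ℕ → Bool) where
  basic n := {x | ∃ w : List Bool, Encodable.decode n = some w ∧ x ∈ cylinder w}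
  isBasis := by
    refine TopologicalSpace.isTopologicalBasis_of_isOpen_of_nhds ?_ ?_
    · rintro _ ⟨n, rfl⟩
      have : {x | ∃ w : List Bool, Encodable.decode n = some w ∧ x ∈ cylinder w} =
          ⋃ (w : List Bool) (_ : Encodable.decode n = some w), cylinder w := by
        ext x; simp
      beta_reduce
      rw [this]
      exact isOpen_iUnion fun w => isOpen_iUnion fun _ => isOpen_cylinder w
    · intro x u hx hu
      obtain ⟨v, ⟨y, n, rfl⟩, hxv, hv⟩ :=
        (PiNat.isTopologicalBasis_cylinders fun _ => Bool).exists_subset_of_mem_open hx hu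
      refine ⟨_, ⟨Encodable.encode (pre x n), rfl⟩, ⟨pre x n, by simp, by simp [cylinder, pre]⟩, ?_⟩
      rintro z ⟨w, hw, hz⟩
      rw [Encodable.encodek, Option.some.injEq] at hw
      subst hw
      refine hv fun i hi => ?_
      rw [← hxv i hi]
      simp only [cylinder, pre, List.length_map, List.length_range, Set.mem_ofPred_eq,
        List.map_inj_left, List.mem_range] at hz
      exact hz i hi
  exists_empty := by
    refine ⟨Nat.pair 2 0 + 1, Set.eq_empty_of_forall_notMem ?_⟩
    rintro x ⟨w, hw, -⟩
    have h2 : (Encodable.decode 2 : Option Bool) = none :=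
      Encodable.decode_ge_two 2 le_rfl
    simp [Encodable.decode_list_succ, h2, Seq.seq] at hw

/-! ### The unit interval with its Cauchy representation -/

section Metric

variable {X : Type*} [MetricSpace X] (α : ℕ → X)

/-- The Cauchy representation with respect to a dense sequence `α`. -/
abbrev cauchyRepresented (hα : DenseRange α) : Represented X where
  IsName p x := (∀ i k, i < k → dist (α (p i)) (α (p k)) ≤ (1 / 2 : ℝ) ^ i) ∧
    Filter.Tendsto (fun i => α (p i)) Filter.atTop (nhds x)
  unique h h' := tendsto_nhds_unique h.2 h'.2
  exists_name x := by
    have h : ∀ i : ℕ, ∃ n, dist (α n) x < (1 / 2 : ℝ) ^ i / 2 := fun i => by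
      obtain ⟨n, hn⟩ := hα.exists_dist_lt x (ε := (1 / 2 : ℝ) ^ i / 2) (by positivity)
      exact ⟨n, by rwa [dist_comm]⟩
    choose p hp using h
    refine ⟨p, fun i k hik => ?_, ?_⟩
    · have h1 := dist_triangle_right (α (p i)) (α (p k)) x
      have h2 : (1 / 2 : ℝ) ^ k ≤ (1 / 2 : ℝ) ^ i :=
        pow_le_pow_of_le_one (by norm_num) (by norm_num) hik.le
      linarith [hp i, hp k]
    · rw [tendsto_iff_dist_tendsto_zero]
      refine squeeze_zero (fun _ => dist_nonneg) (fun i => (hp i).le) ?_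
      simpa using (tendsto_pow_atTop_nhds_zero_of_lt_one (r := (1 / 2 : ℝ))
        (by norm_num) (by norm_num)).div_const 2

/-- The standard numbering of the open balls with center in the sequence `α` and rational
radius (radius `0` yields the empty set). -/
def rationalBall (n : ℕ) : Set X :=
  Metric.ball (α n.unpair.1) ((n.unpair.2.unpair.1 : ℝ) / ((n.unpair.2.unpair.2 : ℝ) + 1))

/-- The rational balls form a numbered basis. -/
abbrev ballBasis (hα : DenseRange α) : NumberedBasis X where
  basic := rationalBall α
  isBasis := by
    refine TopologicalSpace.isTopologicalBasis_of_isOpen_of_nhds ?_ ?_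
    · rintro _ ⟨n, rfl⟩
      exact Metric.isOpen_ball
    · intro x u hx hu
      obtain ⟨r, hr, hru⟩ := Metric.isOpen_iff.1 hu x hx
      obtain ⟨b, hb⟩ := exists_nat_one_div_lt (half_pos hr)
      have hb0 : (0 : ℝ) < 1 / ((b : ℝ) + 1) := by positivity
      obtain ⟨n, hn⟩ := hα.exists_dist_lt x hb0
      refine ⟨_, ⟨Nat.pair n (Nat.pair 1 b), rfl⟩, ?_, fun z hz => hru ?_⟩
      · simpa [rationalBall] using hn
      · have hz' : dist z (α n) < 1 / ((b : ℝ) + 1) := by simpa [rationalBall] using hz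
        rw [Metric.mem_ball]
        have := dist_triangle_right z x (α n)
        linarith
  exists_empty := ⟨Nat.pair 0 (Nat.pair 0 0), by simp [rationalBall]⟩

end Metric

/-- A numbering of the rational numbers in `[0,1]`. -/
noncomputable def ratUnit (n : ℕ) : unitInterval :=
  Set.projIcc 0 1 zero_le_one ((n.unpair.1 : ℝ) / ((n.unpair.2 : ℝ) + 1))

theorem denseRange_ratUnit : DenseRange ratUnit := by
  rw [Metric.denseRange_iff]
  intro x r hr
  obtain ⟨b, hb⟩ := exists_nat_one_div_lt hr
  have hb1 : (0 : ℝ) < (b : ℝ) + 1 := by positivity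
  have h0 : 0 ≤ (x : ℝ) * ((b : ℝ) + 1) := mul_nonneg x.2.1 hb1.le
  set a := ⌊(x : ℝ) * ((b : ℝ) + 1)⌋₊ with ha
  have h1 : (a : ℝ) ≤ (x : ℝ) * ((b : ℝ) + 1) := Nat.floor_le h0
  have h2 : (x : ℝ) * ((b : ℝ) + 1) < a + 1 := Nat.lt_floor_add_one _
  have h3 : (a : ℝ) / ((b : ℝ) + 1) ≤ x := by rwa [div_le_iff₀ hb1]
  have h4 : (x : ℝ) < (a : ℝ) / ((b : ℝ) + 1) + 1 / ((b : ℝ) + 1) := by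
    rwa [← add_div, lt_div_iff₀ hb1]
  refine ⟨Nat.pair a b, ?_⟩
  have h5 : (a : ℝ) / ((b : ℝ) + 1) ∈ Set.Icc (0 : ℝ) 1 := ⟨by positivity, h3.trans x.2.2⟩
  rw [ratUnit, Nat.unpair_pair, Set.projIcc_of_mem _ h5, Subtype.dist_eq, Real.dist_eq, abs_lt]
  constructor <;> simp only <;> linarith

noncomputable instance unitRepresented : Represented unitInterval :=
  cauchyRepresented ratUnit denseRange_ratUnit

noncomputable instance unitBasis : NumberedBasis unitInterval :=
  ballBasis ratUnit denseRange_ratUnit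

/-! ### Binary trees and Weak Weak Kőnig's Lemma -/

/-- A binary tree: a set of finite binary words closed under prefixes. -/
@[ext]
structure BinTree where
  carrier : Set (List Bool)
  prefix_closed : ∀ u v : List Bool, u <+: v → v ∈ carrier → u ∈ carrier

open Classical in
/-- Trees are represented by their characteristic functions, via the standard coding of binary
words by natural numbers (numbers that do not code a word get value `0`). -/
noncomputable instance treeRepresented : Represented BinTree where
  IsName p T := ∀ n, p n = if ∃ w ∈ T.carrier, Encodable.decode n = some w then 1 else 0
  unique {p T S} h h' := by
    ext w
    have := (h (Encodable.encode w)).symm.trans (h' (Encodable.encode w))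
    simp only [Encodable.encodek, Option.some.injEq, exists_eq_right'] at this
    by_cases h1 : w ∈ T.carrier <;> by_cases h2 : w ∈ S.carrier <;> simp_all
  exists_name T := ⟨_, fun _ => rfl⟩

/-- The set `[T]` of infinite paths of `T`. -/
def BinTree.paths (T : BinTree) : Set (ℕ → Bool) := {x | ∀ n, pre x n ∈ T.carrier}

/-- Weak Weak Kőnig's Lemma: `T ↦ [T]` for the trees with `μ [T] > 0`. -/
noncomputable def WWKL : MultiFun BinTree (ℕ → Bool) where
  dom := {T | 0 < cantorMeasure T.paths}
  val T := T.paths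

/-- `ε`-WWKL: the restriction of `WWKL` to the trees with `μ [T] > ε`. -/
noncomputable def quantWWKL (ε : ℝ) : MultiFun BinTree (ℕ → Bool) :=
  WWKL.restrict {T | ENNReal.ofReal ε < cantorMeasure T.paths}

end Weihrauch

namespace Weihrauch

open MeasureTheory

/-! ### Prefixes of sequences -/

/-! For `δ ≤ ε` one problem restricts the other, so identities reduce it. For `ε < δ` the
obstruction is topological and measure-theoretic; of `K` and `H` only continuity is used. Sort the
outputs into `M` cells of measure about `1 / M` and take `t` with `ε < t / M < δ`. Run a supposed
reduction on an instance whose name has so far excluded nothing. The solutions of the instance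
produced by `K` form a decreasing intersection of measurable sets `C m`, and on every solution `H`
eventually commits to a cell. So the part of `C m` on which `H` is still undecided at stage `m`
decreases to the empty set, and its measure drops below `δ - t / M`. The decisions made by stage `m`
partition the space into `M` pieces, and by averaging some `t` of them have total measure at most `t
/ M`. Now continue the name so that only the corresponding `t` cells remain. This is legal, since
about `t / M > ε` of the measure survives. All solutions of the new instance of `g` then lie in the
undecided part or in the `t` light pieces, so their measure is at most `δ`, a contradiction. The
argument is `not_leW_of_hasSmallValues`, resting on `Realizes.forall_solutions` and
`exists_card_eq_mul_sum_le`. Its two hypotheses are verified for choice by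
`hasLargeValues_probChoice` and `hasSmallValues_probChoice`, and for trees by
`hasLargeValues_quantWWKL` and `hasSmallValues_quantWWKL`. -/

@[simp]
theorem length_pre {α : Type*} (p : ℕ → α) (n : ℕ) : (pre p n).length = n := by
  simp [pre]

theorem pre_eq_pre_iff {α : Type*} {p q : ℕ → α} {n : ℕ} :
    pre p n = pre q n ↔ ∀ i < n, p i = q i := by
  simp [pre]

theorem take_pre {α : Type*} (p : ℕ → α) {m n : ℕ} (h : m ≤ n) : (pre p n).take m = pre p m := by
  rw [pre, pre, ← List.map_take, List.take_range, min_eq_left h]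

theorem pre_prefix_pre {α : Type*} (p : ℕ → α) {m n : ℕ} (h : m ≤ n) : pre p m <+: pre p n := by
  rw [← take_pre p h]
  exact List.take_prefix _ _

theorem pre_pair_congr {p p' : ℕ → ℕ} (q : ℕ → ℕ) {m : ℕ} (h : pre p m = pre p' m) :
    pre (pair p q) m = pre (pair p' q) m := by
  rw [pre_eq_pre_iff] at h ⊢
  intro i hi
  simp only [pair]
  rw [h (i / 2) (by omega)]

/-! ### Strong reducibility, reducibility and restrictions -/

theorem isComputable_id : IsComputable fun p => Part.some p := by
  refine ⟨id, Computable.id, fun _ _ h => h, fun p q hq => ?_⟩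
  obtain rfl : q = p := by simpa using hq
  exact ⟨fun m => by simp, fun n => ⟨n, by simp⟩⟩

/-- The word of the letters at odd positions. -/
def oddPart (u : List ℕ) : List ℕ :=
  (List.range (u.length / 2)).map fun k => u.getD (2 * k + 1) 0

theorem computable_oddPart : Computable oddPart := by
  refine Primrec.to_comp ?_
  refine Primrec.list_map (Primrec.list_range.comp
    (Primrec.nat_div.comp Primrec.list_length (Primrec.const 2))) ?_
  exact (Primrec.list_getD 0).comp Primrec.fst
    (Primrec.nat_add.comp (Primrec.nat_mul.comp (Primrec.const 2) Primrec.snd) (Primrec.const 1))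

theorem oddPart_pre (p : ℕ → ℕ) (m : ℕ) :
    oddPart (pre p m) = pre (fun k => p (2 * k + 1)) (m / 2) := by
  simp only [oddPart, pre, List.length_map, List.length_range, List.map_inj_left, List.mem_range]
  intro k hk
  rw [List.getD_eq_getElem _ _ (by simp; omega)]
  simp

theorem oddPart_prefix {u v : List ℕ} (h : u <+: v) : oddPart u <+: oddPart v := by
  -- Words are padded by zeros to sequences, so that `oddPart_pre` applies to both.
  have hv : v = pre (fun i => v.getD i 0) v.length := by
    refine List.ext_getElem (by simp) fun i h1 h2 => ?_
    simp [pre, h1]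
  have hu : u = pre (fun i => v.getD i 0) u.length := by
    rw [← take_pre _ h.length_le, ← hv]
    exact List.prefix_iff_eq_take.1 h
  rw [hu, hv, oddPart_pre, oddPart_pre]
  simp only [← hv]
  exact pre_prefix_pre _ (Nat.div_le_div_right h.length_le)

/-- Turns `H` into a map on pairs that ignores the original input; this is what passing from strong
to ordinary reducibility needs. -/
theorem IsComputable.comp_odd {H : (ℕ → ℕ) →. (ℕ → ℕ)} (hH : IsComputable H) :
    IsComputable fun r => H fun k => r (2 * k + 1) := by
  obtain ⟨φ, hφ, hmono, h⟩ := hH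
  refine ⟨φ ∘ oddPart, hφ.comp computable_oddPart,
    fun u v huv => hmono _ _ (oddPart_prefix huv), fun p q hq => ?_⟩
  obtain ⟨h1, h2⟩ := h _ q hq
  refine ⟨fun m => ?_, fun n => ?_⟩
  · simp only [Function.comp, oddPart_pre]
    exact h1 _
  · obtain ⟨m, hm⟩ := h2 n
    refine ⟨2 * m, ?_⟩
    simpa [oddPart_pre] using hm

section Reducibility

variable {X Y Z W : Type*} [Represented X] [Represented Y] [Represented Z] [Represented W]

theorem LeSW.leW {f : MultiFun X Y} {g : MultiFun Z W} (h : LeSW f g) : LeW f g := by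
  obtain ⟨K, H, hK, hH, h⟩ := h
  refine ⟨K, _, hK, hH.comp_odd, fun G hG => ?_⟩
  have hodd : ∀ p q : ℕ → ℕ, (fun k => pair p q (2 * k + 1)) = q := fun p q => by
    funext k
    simp only [pair]
    rw [if_neg (by omega)]
    congr 1
    omega
  simpa only [hodd] using h G hG

theorem MultiFun.leSW_of_subset {f g : MultiFun X Y} (hdom : f.dom ⊆ g.dom)
    (hval : ∀ x ∈ f.dom, g.val x ⊆ f.val x) : LeSW f g := by
  refine ⟨_, _, isComputable_id, isComputable_id, fun G hG p x hp hx => ?_⟩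
  obtain ⟨q, hq, y, hy, hyx⟩ := hG p x hp (hdom hx)
  exact ⟨q, Part.mem_bind_iff.2 ⟨q, Part.mem_bind_iff.2 ⟨p, Part.mem_some p, hq⟩, Part.mem_some q⟩,
    y, hy, hval x hx hyx⟩

/-- What a reduction does on a single name, for all names of all solutions of the resulting
instance. -/
theorem Realizes.forall_solutions {f : MultiFun X Y} {g : MultiFun Z W}
    (hg : ∀ z ∈ g.dom, (g.val z).Nonempty) {K H : (ℕ → ℕ) →. (ℕ → ℕ)}
    (h : ∀ G : (ℕ → ℕ) →. (ℕ → ℕ), Realizes G g →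
      Realizes (fun p => ((K p).bind G).bind fun q => H (pair p q)) f)
    {p : ℕ → ℕ} {x : X} (hp : Represented.IsName p x) (hx : x ∈ f.dom) :
    ∃ q ∈ K p, ∃ z ∈ g.dom, Represented.IsName q z ∧
      ∀ r, ∀ w ∈ g.val z, Represented.IsName r w →
        ∃ s ∈ H (pair p r), ∃ y ∈ f.val x, Represented.IsName s y := by
  classical
  have hsol : ∀ q, (∃ z ∈ g.dom, Represented.IsName q z) →
      ∃ r, ∃ w, Represented.IsName r w ∧ ∃ z ∈ g.dom, Represented.IsName q z ∧ w ∈ g.val z := by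
    rintro q ⟨z, hz, hqz⟩
    obtain ⟨w, hw⟩ := hg z hz
    obtain ⟨r, hr⟩ := Represented.exists_name w
    exact ⟨r, w, hr, z, hz, hqz, hw⟩
  choose! c hc using hsol
  -- A realizer defined only on names of instances forces `K p` to be such a name.
  have key : ∃ q ∈ K p, ∃ z ∈ g.dom, Represented.IsName q z := by
    let G : (ℕ → ℕ) →. (ℕ → ℕ) := fun q =>
      ⟨∃ z ∈ g.dom, Represented.IsName q z, fun _ => c q⟩
    have hG : Realizes G g := fun q z hqz hz => by
      obtain ⟨w, hw, z', hz', hqz', hwz'⟩ := hc q ⟨z, hz, hqz⟩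
      obtain rfl := Represented.unique hqz hqz'
      exact ⟨c q, ⟨⟨z, hz, hqz⟩, rfl⟩, w, hw, hwz'⟩
    obtain ⟨s, hs, -⟩ := h G hG p x hp hx
    obtain ⟨r, hr, -⟩ := Part.mem_bind_iff.1 hs
    obtain ⟨q, hq, hqr⟩ := Part.mem_bind_iff.1 hr
    exact ⟨q, hq, hqr.1⟩
  obtain ⟨q, hq, z, hz, hqz⟩ := key
  refine ⟨q, hq, z, hz, hqz, fun r w hw hr => ?_⟩
  -- Realizers need not respect equality of instances, so changing the value at the single name `q`
  -- to `r` gives another realizer.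
  let G : (ℕ → ℕ) →. (ℕ → ℕ) := fun q' => Part.some (if q' = q then r else c q')
  have hG : Realizes G g := fun q' z' hqz' hz' => by
    by_cases hqq : q' = q
    · subst hqq
      obtain rfl := Represented.unique hqz hqz'
      exact ⟨r, by simp [G], w, hr, hw⟩
    · obtain ⟨w', hw', z'', hz'', hqz'', hwz''⟩ := hc q' ⟨z', hz', hqz'⟩
      obtain rfl := Represented.unique hqz' hqz''
      exact ⟨c q', by simp [G, hqq], w', hw', hwz''⟩
  obtain ⟨s, hs, y, hy, hyx⟩ := h G hG p x hp hx
  obtain ⟨r', hr', hs'⟩ := Part.mem_bind_iff.1 hs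
  obtain ⟨q', hq', hqr⟩ := Part.mem_bind_iff.1 hr'
  obtain rfl := Part.mem_unique hq hq'
  obtain rfl : r' = r := by simpa [G] using hqr
  exact ⟨s, hs', y, hyx, hy⟩

end Reducibility

/-! ### Lower bounds from measure -/

/-- Some `t` of the summands contribute at most their proportional share. -/
theorem exists_card_eq_mul_sum_le {ι : Type*} [DecidableEq ι] (a : ι → ℝ) (s : Finset ι) {t : ℕ}
    (ht : t ≤ s.card) :
    ∃ T ⊆ s, T.card = t ∧ (s.card : ℝ) * ∑ i ∈ T, a i ≤ t * ∑ i ∈ s, a i := by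
  induction s using Finset.strongInduction with
  | H s ih =>
    obtain rfl | ht' := ht.eq_or_lt
    · exact ⟨s, subset_rfl, rfl, le_rfl⟩
    obtain rfl | ht0 := t.eq_zero_or_pos
    · exact ⟨∅, by simp, by simp, by simp⟩
    have hs : s.Nonempty := Finset.card_pos.1 (by omega)
    -- Discarding a largest summand does not raise the average.
    obtain ⟨i, hi, hmax⟩ := s.exists_max_image a hs
    have hcard : (s.erase i).card = s.card - 1 := Finset.card_erase_of_mem hi
    obtain ⟨T, hT, hTt, hsum⟩ := ih _ (Finset.erase_ssubset hi) (by omega)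
    refine ⟨T, hT.trans (Finset.erase_subset _ _), hTt, ?_⟩
    have h1 : ∑ j ∈ s, a j ≤ s.card * a i := by
      simpa using Finset.sum_le_card_nsmul s a (a i) hmax
    have h2 := Finset.add_sum_erase s a hi
    have hc : ((s.erase i).card : ℝ) = s.card - 1 := by
      rw [hcard, Nat.cast_sub (by omega)]; simp
    rw [hc, ← sub_eq_of_eq_add' h2.symm] at hsum
    have hn : (1 : ℝ) < s.card := by exact_mod_cast (by omega : 1 < s.card)
    have ht0' : (0 : ℝ) < t := by exact_mod_cast ht0
    have h3 : ((s.card : ℝ) - 1) * (s.card * ∑ j ∈ T, a j) ≤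
        ((s.card : ℝ) - 1) * (t * ∑ j ∈ s, a j) := by
      nlinarith
    exact le_of_mul_le_mul_left h3 (by linarith)

/-- A prefix of fixed length takes values in a countable discrete space, on which every `F` is
measurable. -/
theorem measurable_comp_pre {Ω α : Type*} [MeasurableSpace Ω] [MeasurableSpace α]
    {c : Ω → ℕ → ℕ} (hc : ∀ n, Measurable fun ω => c ω n) (F : List ℕ → α) (m : ℕ) :
    Measurable fun ω => F (pre (c ω) m) := by
  have h : (fun ω => F (pre (c ω) m)) =
      (fun v : Fin m → ℕ => F (List.ofFn v)) ∘ fun ω i => c ω i := by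
    funext ω
    simp only [Function.comp]
    congr 1
    refine List.ext_getElem (by simp) fun i h1 h2 => ?_
    simp [pre]
  rw [h]
  exact (measurable_of_countable _).comp (measurable_pi_lambda _ fun i => hc i)

/-- The solution sets of `g` have measure above `δ`, they are approximated from outside by
measurable sets determined by finite prefixes of the instance, and solutions have names that depend
measurably on them. -/
structure HasLargeValues {Z W : Type*} [Represented Z] [Represented W] [MeasurableSpace W]
    (g : MultiFun Z W) (ν : Measure W) (δ : ℝ) : Prop where
  lt_measure : ∀ z ∈ g.dom, ENNReal.ofReal δ < ν (g.val z)
  exists_name : ∃ c : W → ℕ → ℕ, (∀ n, Measurable fun w => c w n) ∧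
    ∀ w, Represented.IsName (c w) w
  exists_approx : ∃ E : List ℕ → Set W, (∀ u, MeasurableSet (E u)) ∧
    (∀ u v, u <+: v → E v ⊆ E u) ∧
    ∀ q z, Represented.IsName q z → z ∈ g.dom → g.val z = ⋂ l, E (pre q l)

/-- Names of solutions of `f` are sorted into cells `ι` by a finite prefix, and some instance of `f`
can at any moment be changed so that all solutions are in `t` prescribed cells. -/
def HasSmallValues {X Y : Type*} [Represented X] [Represented Y] (f : MultiFun X Y)
    (ι : Type*) (t : ℕ) : Prop :=
  ∃ (p₀ : ℕ → ℕ) (x₀ : X) (N : ℕ) (j : List ℕ → ι), Represented.IsName p₀ x₀ ∧ x₀ ∈ f.dom ∧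
    ∀ (m : ℕ) (T : Finset ι), T.card = t → ∃ p x, pre p m = pre p₀ m ∧
      Represented.IsName p x ∧ x ∈ f.dom ∧
      ∀ s y, Represented.IsName s y → y ∈ f.val x → j (pre s N) ∈ T

/-- The sets below are `C m`, the points not yet excluded by the prefix of `K p₀` known at stage
`m`; `D m`, the points on which `H` has written `N` letters; and the cell `i m w` read off those
letters. -/
theorem not_leW_of_hasSmallValues {X Y Z W : Type*} [Represented X] [Represented Y]
    [Represented Z] [Represented W] [MeasurableSpace W] {f : MultiFun X Y} {g : MultiFun Z W}
    {ν : Measure W} [IsProbabilityMeasure ν] {δ : ℝ} {ι : Type*} [Fintype ι] {t : ℕ}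
    (hf : HasSmallValues f ι t) (hg : HasLargeValues g ν δ) (htι : t ≤ Fintype.card ι)
    (hδ : (t : ℝ) / Fintype.card ι < δ) : ¬ LeW f g := by
  classical
  rintro ⟨K, H, ⟨φ, -, hφ, hK⟩, ⟨ψ, -, hψ, hH⟩, h⟩
  obtain ⟨p₀, x₀, N, j, hp₀, hx₀, hf⟩ := hf
  obtain ⟨hlarge, ⟨c, hc, hcn⟩, E, hEm, hE, hval⟩ := hg
  have hne : ∀ z ∈ g.dom, (g.val z).Nonempty := fun z hz =>
    nonempty_of_measure_ne_zero (bot_le.trans_lt (hlarge z hz)).ne'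
  have hsol := fun p x => Realizes.forall_solutions hne h (p := p) (x := x)
  obtain ⟨q₀, hq₀, z₀, hz₀, hqz₀, hr₀⟩ := hsol p₀ x₀ hp₀ hx₀
  have hcp : ∀ n, Measurable fun w => pair p₀ (c w) n := fun n => by
    by_cases hn : n % 2 = 0
    · simp [pair, hn]
    · simpa [pair, hn] using hc (n / 2)
  let C : ℕ → Set W := fun m => E (φ (pre p₀ m))
  let D : ℕ → Set W := fun m => {w | N ≤ (ψ (pre (pair p₀ (c w)) m)).length}
  let i : ℕ → W → ι := fun m w => j ((ψ (pre (pair p₀ (c w)) m)).take N)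
  have hDm : ∀ m, MeasurableSet (D m) := fun m =>
    measurable_comp_pre hcp (fun u => (ψ u).length) m (MeasurableSet.of_discrete (s := Set.Ici N))
  have him : ∀ m k, MeasurableSet (i m ⁻¹' {k}) := fun m k => by
    let _ : MeasurableSpace ι := ⊤
    exact measurable_comp_pre hcp (fun u => j ((ψ u).take N)) m (MeasurableSet.of_discrete)
  have hanti : Antitone fun m => C m \ D m := fun m n hmn => by
    refine Set.sdiff_subset_sdiff (hE _ _ (hφ _ _ (pre_prefix_pre _ hmn))) fun w hw => ?_
    exact le_trans (show N ≤ _ from hw) (hψ _ _ (pre_prefix_pre _ hmn)).length_le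
  -- A point in every `C m` is a solution for `p₀`, so `H` must produce `N` letters on it at some
  -- stage.
  have hempty : ⋂ m, C m \ D m = ∅ := by
    refine Set.eq_empty_of_forall_notMem fun w hw => ?_
    rw [Set.mem_iInter] at hw
    obtain ⟨hpre, hlen⟩ := hK p₀ q₀ hq₀
    have hwz : w ∈ g.val z₀ := by
      rw [hval q₀ z₀ hqz₀ hz₀, Set.mem_iInter]
      intro l
      obtain ⟨m, hm⟩ := hlen l
      refine hE _ _ ?_ (hw m).1
      rw [hpre m]
      exact pre_prefix_pre _ hm
    obtain ⟨s, hs, -⟩ := hr₀ (c w) w hwz (hcn w)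
    obtain ⟨m, hm⟩ := (hH _ s hs).2 N
    exact (hw m).2 hm
  have hlim := tendsto_measure_iInter_atTop (μ := ν)
    (fun m => ((hEm _).diff (hDm m)).nullMeasurableSet) hanti ⟨0, measure_ne_top _ _⟩
  rw [hempty, measure_empty] at hlim
  obtain ⟨m, hm⟩ := (hlim.eventually_lt_const
    (ENNReal.ofReal_pos.2 (sub_pos.2 hδ))).exists
  have hsum : ∑ k, ν.real (i m ⁻¹' {k}) = 1 := by
    rw [← measureReal_biUnion_finset (fun a _ b _ hab => ?_) fun k _ => him m k]
    · have : ⋃ k ∈ Finset.univ, i m ⁻¹' {k} = Set.univ := by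
        ext w; simp
      rw [this]; simp
    · exact (Set.disjoint_singleton.2 hab).preimage _
  have hι : (0 : ℝ) < Fintype.card ι := by
    have : Nonempty ι := ⟨j []⟩
    exact_mod_cast Fintype.card_pos
  obtain ⟨T, -, hT, hTsum⟩ :=
    exists_card_eq_mul_sum_le (fun k => ν.real (i m ⁻¹' {k})) Finset.univ htι
  rw [hsum, mul_one, Finset.card_univ, mul_comm, ← le_div_iff₀ hι] at hTsum
  obtain ⟨p, x, hpm, hpx, hx, hxT⟩ := hf m T hT
  obtain ⟨q, hq, z, hz, hqz, hr⟩ := hsol p x hpx hx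
  -- As `p` and `p₀` agree up to `m`, both `C m` and the decisions already made remain valid for the
  -- new instance.
  have hsub : g.val z ⊆ (C m \ D m) ∪ ⋃ k ∈ T, i m ⁻¹' {k} := fun w hw => by
    have hwC : w ∈ C m := by
      rw [hval q z hqz hz, Set.mem_iInter] at hw
      have := hw (φ (pre p m)).length
      rwa [← (hK p q hq).1 m, hpm] at this
    by_cases hwD : w ∈ D m
    · right
      obtain ⟨s, hs, y, hy, hsy⟩ := hr (c w) w hw (hcn w)
      have hj := hxT s y hsy hy
      have hψs := (hH _ s hs).1 m
      rw [pre_pair_congr (c w) hpm] at hψs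
      have : pre s N = (ψ (pre (pair p₀ (c w)) m)).take N := by
        rw [hψs, take_pre _ hwD]
      simpa [i, ← this] using hj
    · exact Or.inl ⟨hwC, hwD⟩
  have h1 : ν (⋃ k ∈ T, i m ⁻¹' {k}) ≤ ENNReal.ofReal (t / Fintype.card ι) := by
    rw [← ofReal_measureReal (measure_ne_top _ _)]
    exact ENNReal.ofReal_le_ofReal ((measureReal_biUnion_finset_le _ _).trans hTsum)
  have h2 := (measure_mono (μ := ν) hsub).trans (measure_union_le _ _)
  have h3 : ν (C m \ D m) + ν (⋃ k ∈ T, i m ⁻¹' {k}) ≤ ENNReal.ofReal δ := by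
    refine (add_le_add hm.le h1).trans ?_
    rw [← ENNReal.ofReal_add (sub_pos.2 hδ).le (by positivity)]
    simp
  exact ((hlarge z hz).trans_le (h2.trans h3)).false

/-! ### Probabilistic choice -/

/-- A union bound over the removed sets, so they are allowed to overlap. -/
theorem ofReal_lt_measure_compl_biUnion {X : Type*} [MeasurableSpace X] (μ : Measure X)
    [IsProbabilityMeasure μ] {ι : Type*} [Fintype ι] [DecidableEq ι] {U : ι → Set X}
    (hU : ∀ i, MeasurableSet (U i)) {β ε : ℝ} (hβ : ∀ i, μ.real (U i) ≤ β) (hε : 0 ≤ ε)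
    {T : Finset ι} (hT : ε < 1 - ((Fintype.card ι : ℝ) - T.card) * β) :
    ENNReal.ofReal ε < μ (⋃ i ∈ Tᶜ, U i)ᶜ := by
  have h1 : μ.real (⋃ i ∈ Tᶜ, U i) ≤ ((Fintype.card ι : ℝ) - T.card) * β := by
    refine (measureReal_biUnion_finset_le _ _).trans ?_
    refine (Finset.sum_le_card_nsmul _ _ β fun i _ => hβ i).trans ?_
    rw [Finset.card_compl, nsmul_eq_mul, Nat.cast_sub (Finset.card_le_univ T)]
  have h2 : ε < μ.real (⋃ i ∈ Tᶜ, U i)ᶜ := by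
    rw [probReal_compl_eq_one_sub (Finset.measurableSet_biUnion _ fun i _ => hU i)]
    linarith
  rw [← ofReal_measureReal (measure_ne_top _ _)]
  exact (ENNReal.ofReal_lt_ofReal_iff (hε.trans_lt h2)).2 h2

section Closeds

variable {X : Type*} [TopologicalSpace X] [NumberedBasis X]

theorem isOpen_basic (n : ℕ) : IsOpen (NumberedBasis.basic (X := X) n) :=
  NumberedBasis.isBasis.isOpen ⟨n, rfl⟩

theorem hasLargeValues_probChoice [MeasurableSpace X] [OpensMeasurableSpace X] [Represented X]
    (μ : Measure X) {δ : ℝ}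
    (hc : ∃ c : X → ℕ → ℕ, (∀ n, Measurable fun x => c x n) ∧ ∀ x, Represented.IsName (c x) x) :
    HasLargeValues (probChoice μ (Set.Ioi (ENNReal.ofReal δ))) μ δ where
  lt_measure A hA := hA.2
  exists_name := hc
  exists_approx := by
    refine ⟨fun u => (⋃ n ∈ u, NumberedBasis.basic (X := X) n)ᶜ, fun u => ?_, fun u v huv => ?_,
      fun q A hq _ => ?_⟩
    · exact (isOpen_biUnion fun n _ => isOpen_basic n).measurableSet.compl
    · exact Set.compl_subset_compl.2 (Set.biUnion_subset_biUnion_left fun n hn => huv.subset hn)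
    · refine Eq.trans hq ?_
      ext x
      simp only [pre, Set.mem_compl_iff, Set.mem_iUnion, not_exists, Set.mem_iInter, List.mem_map,
        List.mem_range, exists_prop, not_and, forall_exists_index, and_imp]
      constructor
      · rintro h l _ i _ rfl
        exact h i
      · intro h i
        exact h (i + 1) _ i (by omega) rfl

/-- Listing the empty set delays information: a name of the whole space can after any stage become a
name of the complement of the unwanted `U i`. A solution sorted into cell `i` lies in `U i`, hence
`i` was not removed. -/
theorem hasSmallValues_probChoice [MeasurableSpace X] [OpensMeasurableSpace X] [Represented X]
    (μ : Measure X) [IsProbabilityMeasure μ] {ι : Type*} [Fintype ι] {U : ι → Set X}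
    (hU : ∀ i, IsOpen (U i)) {N : ℕ} {j : List ℕ → ι}
    (hj : ∀ s y, Represented.IsName s y → y ∈ U (j (pre s N))) {β ε : ℝ}
    (hβ : ∀ i, μ.real (U i) ≤ β) (hε : 0 ≤ ε) (hε1 : ε < 1) {t : ℕ}
    (ht : ε < 1 - ((Fintype.card ι : ℝ) - t) * β) :
    HasSmallValues (probChoice μ (Set.Ioi (ENNReal.ofReal ε))) ι t := by
  classical
  obtain ⟨n₀, hn₀⟩ := NumberedBasis.exists_empty (X := X)
  have hdom : ∀ A : TopologicalSpace.Closeds X, ENNReal.ofReal ε < μ (A : Set X) →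
      A ∈ (probChoice μ (Set.Ioi (ENNReal.ofReal ε))).dom := fun A hA =>
    ⟨nonempty_of_measure_ne_zero (bot_le.trans_lt hA).ne', hA⟩
  refine ⟨fun _ => n₀, ⊤, N, j, ?_, hdom _ ?_, fun m T hT => ?_⟩
  · simp [Represented.IsName, hn₀]
  · simpa using hε1
  · have hopen : IsOpen (⋃ i ∈ Tᶜ, U i) := isOpen_biUnion fun i _ => hU i
    let A : TopologicalSpace.Closeds X := ⟨(⋃ i ∈ Tᶜ, U i)ᶜ, hopen.isClosed_compl⟩
    obtain ⟨p, hp⟩ := Represented.exists_name A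
    refine ⟨fun i => if i < m then n₀ else p (i - m), A, ?_, ?_, hdom A ?_, fun s y hs hy => ?_⟩
    · exact pre_eq_pre_iff.2 fun i hi => if_pos hi
    · refine Eq.trans hp (congrArg _ ?_)
      ext x
      simp only [Set.mem_iUnion]
      constructor
      · rintro ⟨i, hi⟩
        exact ⟨i + m, by simpa using hi⟩
      · rintro ⟨i, hi⟩
        split_ifs at hi with him
        · simp [hn₀] at hi
        · exact ⟨i - m, hi⟩
    · exact ofReal_lt_measure_compl_biUnion μ (fun i => (hU i).measurableSet) hβ hε (by rwa [hT])
    · by_contra hjT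
      exact hy (Set.mem_biUnion (Finset.mem_coe.2 (Finset.mem_compl.2 hjT)) (hj s y hs))

end Closeds

theorem exists_nat_div_mem_Ioo {ε δ : ℝ} (hε : 0 ≤ ε) {M : ℕ} (hM : 1 / (M : ℝ) < δ - ε)
    (hM0 : 0 < M) : ∃ t : ℕ, ε < (t : ℝ) / M ∧ (t : ℝ) / M < δ := by
  have hM0' : (0 : ℝ) < M := by exact_mod_cast hM0
  -- The floor plus one, not the ceiling, keeps the lower bound strict when `ε * M` is an integer.
  refine ⟨⌊ε * M⌋₊ + 1, ?_, ?_⟩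
  · rw [lt_div_iff₀ hM0']
    push_cast
    exact Nat.lt_floor_add_one _
  · push_cast
    rw [add_div]
    have : (⌊ε * M⌋₊ : ℝ) / M ≤ ε := by
      rw [div_le_iff₀ hM0']
      exact Nat.floor_le (by positivity)
    linarith

theorem le_of_div_lt_of_le_one {t M : ℕ} {δ : ℝ} (hM0 : 0 < M) (h : (t : ℝ) / M < δ) (hδ : δ ≤ 1) :
    t ≤ M := by
  have hM0' : (0 : ℝ) < M := by exact_mod_cast hM0
  have := (div_lt_one hM0').1 (h.trans_le hδ)
  exact_mod_cast this.le

theorem probChoice_leSW_of_le {X : Type*} [TopologicalSpace X] [NumberedBasis X]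
    [MeasurableSpace X] [Represented X] (μ : Measure X) {ε δ : ℝ} (h : δ ≤ ε) :
    LeSW (probChoice μ (Set.Ioi (ENNReal.ofReal ε)))
      (probChoice μ (Set.Ioi (ENNReal.ofReal δ))) :=
  MultiFun.leSW_of_subset
    (Set.inter_subset_inter_right _ fun _ hA => (ENNReal.ofReal_le_ofReal h).trans_lt hA)
    fun _ _ => subset_rfl

/-! ### Cantor space -/

instance isProbabilityMeasure_cantorMeasure : IsProbabilityMeasure cantorMeasure := by
  unfold cantorMeasure
  infer_instance

theorem exists_measurable_name_cantor :
    ∃ c : (ℕ → Bool) → ℕ → ℕ, (∀ n, Measurable fun x => c x n) ∧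
      ∀ x, Represented.IsName (c x) x :=
  ⟨fun x n => (x n).toNat,
    fun n => (measurable_of_countable Bool.toNat).comp (measurable_pi_apply n), fun _ _ => rfl⟩

/-- The cylinder of all sequences that begin with `v`. -/
def cell {n : ℕ} (v : Fin n → Bool) : Set (ℕ → Bool) := {x | ∀ i : Fin n, x i = v i}

theorem isOpen_cell {n : ℕ} (v : Fin n → Bool) : IsOpen (cell v) := by
  have : cell v = (fun x : ℕ → Bool => fun i : Fin n => x i) ⁻¹' {v} := by
    ext x
    simp [cell, funext_iff]
  rw [this]
  exact (isOpen_discrete _).preimage (by fun_prop)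

theorem cantorMeasure_real_cell {n : ℕ} (v : Fin n → Bool) :
    cantorMeasure.real (cell v) = 1 / (2 : ℝ) ^ n := by
  -- The default `false` is never used, since only coordinates below `n` are constrained.
  have : cell v = Set.pi (Finset.range n)
      fun i => {if h : i < n then v ⟨i, h⟩ else false} := by
    ext x
    simp only [cell, Set.mem_ofPred_eq, Set.mem_pi, Finset.coe_range, Set.mem_Iio,
      Set.mem_singleton_iff]
    exact ⟨fun h i hi => by simp [hi, h ⟨i, hi⟩], fun h i => by simpa using h i i.2⟩
  rw [this, cantorMeasure, measureReal_def, Measure.infinitePi_pi _ fun _ _ => by measurability]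
  have hhalf : ∀ b : Bool, (PMF.uniformOfFintype Bool).toMeasure {b} = 2⁻¹ := fun b => by
    rw [PMF.toMeasure_apply_singleton _ _ (measurableSet_singleton b)]
    simp
  simp only [hhalf]
  simp

/-- The cell of a sequence, from a prefix of a name. -/
def cellIndex (n : ℕ) (u : List ℕ) : Fin n → Bool := fun i => decide (u.getD i 0 = 1)

theorem cellIndex_pre {n : ℕ} {s : ℕ → ℕ} {y : ℕ → Bool} (h : Represented.IsName s y)
    (i : Fin n) : cellIndex n (pre s n) i = y i := by
  have hs : s i = (y i).toNat := h i
  simp only [cellIndex]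
  rw [List.getD_eq_getElem _ _ (by simp)]
  simp only [pre, List.getElem_map, List.getElem_range, hs]
  cases y i <;> simp

theorem mem_cell_cellIndex {n : ℕ} {s : ℕ → ℕ} {y : ℕ → Bool} (h : Represented.IsName s y) :
    y ∈ cell (cellIndex n (pre s n)) := fun i => (cellIndex_pre h i).symm

theorem exists_dyadic_mem_Ioo {ε δ : ℝ} (hε : 0 ≤ ε) (h : ε < δ) :
    ∃ n t : ℕ, ε < (t : ℝ) / (2 ^ n : ℕ) ∧ (t : ℝ) / (2 ^ n : ℕ) < δ := by
  obtain ⟨n, hn⟩ := exists_pow_lt_of_lt_one (sub_pos.2 h) (by norm_num : (1 / 2 : ℝ) < 1)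
  refine ⟨n, exists_nat_div_mem_Ioo hε ?_ (by positivity)⟩
  simpa using hn

theorem lt_one_sub_of_lt_dyadic {ε : ℝ} {n t : ℕ} (h : ε < (t : ℝ) / (2 ^ n : ℕ)) :
    ε < 1 - ((Fintype.card (Fin n → Bool) : ℝ) - t) * (1 / (2 : ℝ) ^ n) := by
  have e : 1 - ((2 : ℝ) ^ n - t) * (1 / 2 ^ n) = t / 2 ^ n := by
    field_simp
    ring
  simpa [← e] using h

theorem not_leW_probChoice_cantor {ε δ : ℝ} (hε : 0 ≤ ε) (hδ : δ ≤ 1) (h : ε < δ) :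
    ¬ LeW (probChoice cantorMeasure (Set.Ioi (ENNReal.ofReal ε)))
      (probChoice cantorMeasure (Set.Ioi (ENNReal.ofReal δ))) := by
  obtain ⟨n, t, hεt, htδ⟩ := exists_dyadic_mem_Ioo hε h
  have hcard : Fintype.card (Fin n → Bool) = 2 ^ n := by simp
  exact not_leW_of_hasSmallValues (ι := Fin n → Bool) (t := t)
    (hasSmallValues_probChoice cantorMeasure (U := cell) isOpen_cell
      (fun s y => mem_cell_cellIndex) (fun v => (cantorMeasure_real_cell v).le) hε
      (h.trans_le hδ) (lt_one_sub_of_lt_dyadic hεt))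
    (hasLargeValues_probChoice cantorMeasure exists_measurable_name_cantor)
    (hcard ▸ le_of_div_lt_of_le_one (by positivity) htδ hδ) (by rwa [hcard])

/-! ### Binary trees -/

theorem quantWWKL_leSW_of_le {ε δ : ℝ} (h : δ ≤ ε) : LeSW (quantWWKL ε) (quantWWKL δ) :=
  MultiFun.leSW_of_subset
    (Set.inter_subset_inter_right _ fun _ hA => (ENNReal.ofReal_le_ofReal h).trans_lt hA)
    fun _ _ => subset_rfl

theorem hasLargeValues_quantWWKL (δ : ℝ) : HasLargeValues (quantWWKL δ) cantorMeasure δ where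
  lt_measure T hT := hT.2
  exists_name := exists_measurable_name_cantor
  exists_approx := by
    -- A value zero at the code of `w` excludes the cylinder of `w`; the approximation removes the
    -- cylinders excluded so far.
    refine ⟨fun u => {x | ∀ w : List Bool, u[Encodable.encode w]? = some 0 → x ∉ cylinder w},
      fun u => ?_, fun u v huv x hx w hw => hx w ?_, fun q T hq _ => ?_⟩
    · simp only [Set.ofPred_forall]
      refine MeasurableSet.iInter fun w => MeasurableSet.iInter fun _ => ?_
      exact (isOpen_cylinder w).measurableSet.compl
    · obtain ⟨l, rfl⟩ := huv
      rw [List.getElem?_append_left (List.getElem?_eq_some_iff.1 hw).1]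
      exact hw
    · have hw : ∀ w : List Bool, w ∈ T.carrier ↔ q (Encodable.encode w) ≠ 0 := fun w => by
        rw [hq]
        simp
      ext x
      simp only [Set.mem_iInter, Set.mem_ofPred_eq]
      constructor
      · intro hx l w hl hxw
        obtain ⟨hlen, hlw⟩ := List.getElem?_eq_some_iff.1 hl
        have h0 : q (Encodable.encode w) = 0 := by simpa [pre] using hlw
        have hmem : w ∈ T.carrier := by
          have := hx w.length
          rwa [show pre x w.length = w from hxw] at this
        exact (hw w).1 hmem h0
      · intro hx n
        by_contra hn
        have hq0 : q (Encodable.encode (pre x n)) = 0 := by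
          by_contra h0
          exact hn ((hw _).2 h0)
        refine hx (Encodable.encode (pre x n) + 1) (pre x n) ?_ ?_
        · simp [pre] at hq0 ⊢
          exact hq0
        · simp [cylinder]

/-- The tree that is full up to length `L` and above has only words with prefix in `T`. -/
def cellTree {n : ℕ} (T : Finset (Fin n → Bool)) (L : ℕ) : BinTree where
  carrier := {w | L < w.length → ∀ v : Fin n → Bool,
    (∀ i : Fin n, w[(i : ℕ)]? = some (v i)) → v ∈ T}
  prefix_closed u w huw hw hL v hv := by
    refine hw (hL.trans_le huw.length_le) v fun i => ?_
    obtain ⟨l, rfl⟩ := huw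
    rw [List.getElem?_append_left (List.getElem?_eq_some_iff.1 (hv i)).1]
    exact hv i

/-- The full part up to level `L` leaves no trace, because every path has prefixes longer than `L`.
-/
theorem paths_cellTree {n : ℕ} (T : Finset (Fin n → Bool)) (L : ℕ) :
    (cellTree T L).paths = (⋃ v ∈ Tᶜ, cell v)ᶜ := by
  ext x
  simp only [BinTree.paths, cellTree, Set.mem_ofPred_eq, Set.mem_compl_iff, Set.mem_iUnion,
    Finset.mem_compl, exists_prop, not_exists, not_and, length_pre]
  constructor
  · intro hx v hv hxv
    -- This length exceeds `L`, so the constraint is active, and `n`, so the whole index `v` is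
    -- visible.
    refine hv (hx (L + n + 1) (by omega) v fun i => ?_)
    have hi : (i : ℕ) < L + n + 1 := by omega
    simp [pre, hi, hxv i]
  · intro hx m _ v hv
    by_contra hvT
    refine hx v hvT fun i => ?_
    have := hv i
    obtain ⟨h1, h2⟩ := List.getElem?_eq_some_iff.1 this
    simpa [pre] using h2

theorem hasSmallValues_quantWWKL {ε : ℝ} (hε : 0 ≤ ε) (hε1 : ε < 1) {n t : ℕ}
    (ht : ε < 1 - ((Fintype.card (Fin n → Bool) : ℝ) - t) * (1 / (2 : ℝ) ^ n)) :
    HasSmallValues (quantWWKL ε) (Fin n → Bool) t := by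
  classical
  have hdom : ∀ T : BinTree, ENNReal.ofReal ε < cantorMeasure T.paths → T ∈ (quantWWKL ε).dom :=
    fun T hT => ⟨bot_le.trans_lt hT, hT⟩
  let full : BinTree := ⟨Set.univ, fun _ _ _ _ => trivial⟩
  have hfull : full.paths = Set.univ := by
    ext x
    simp [full, BinTree.paths]
  obtain ⟨p₀, hp₀⟩ := Represented.exists_name full
  refine ⟨p₀, full, n, cellIndex n, hp₀, hdom _ ?_, fun m T hT => ?_⟩
  · simpa [hfull] using hε1
  · let len : ℕ → ℕ := fun i => ((Encodable.decode i : Option (List Bool)).getD []).length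
    let L := (Finset.range m).sup len
    obtain ⟨p, hp⟩ := Represented.exists_name (cellTree T L)
    refine ⟨p, cellTree T L, pre_eq_pre_iff.2 fun i hi => ?_, hp, hdom _ ?_, fun s y hs hy => ?_⟩
    · rw [hp, hp₀]
      refine if_congr ⟨?_, ?_⟩ rfl rfl
      · rintro ⟨w, -, hw⟩
        exact ⟨w, trivial, hw⟩
      · rintro ⟨w, -, hw⟩
        refine ⟨w, fun hL => ?_, hw⟩
        have := Finset.le_sup (f := len) (Finset.mem_range.2 hi)
        simp only [len, hw, Option.getD_some] at this
        exact absurd hL this.not_gt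
    · rw [paths_cellTree]
      exact ofReal_lt_measure_compl_biUnion cantorMeasure (fun v => (isOpen_cell v).measurableSet)
        (fun v => (cantorMeasure_real_cell v).le) hε (by rwa [hT])
    · change y ∈ (cellTree T L).paths at hy
      rw [paths_cellTree] at hy
      by_contra hjT
      exact hy (Set.mem_biUnion (Finset.mem_coe.2 (Finset.mem_compl.2 hjT)) (mem_cell_cellIndex hs))

theorem not_leW_quantWWKL {ε δ : ℝ} (hε : 0 ≤ ε) (hδ : δ ≤ 1) (h : ε < δ) :
    ¬ LeW (quantWWKL ε) (quantWWKL δ) := by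
  obtain ⟨n, t, hεt, htδ⟩ := exists_dyadic_mem_Ioo hε h
  have hcard : Fintype.card (Fin n → Bool) = 2 ^ n := by simp
  exact not_leW_of_hasSmallValues (hasSmallValues_quantWWKL hε (h.trans_le hδ)
    (lt_one_sub_of_lt_dyadic hεt)) (hasLargeValues_quantWWKL δ)
    (hcard ▸ le_of_div_lt_of_le_one (by positivity) htδ hδ) (by rwa [hcard])

/-! ### The unit interval -/

theorem coe_ratUnit_of_le {a b : ℕ} (h : a ≤ b + 1) :
    (ratUnit (Nat.pair a b) : ℝ) = (a : ℝ) / ((b : ℝ) + 1) := by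
  have hb : (0 : ℝ) < (b : ℝ) + 1 := by positivity
  have h' : (a : ℝ) / ((b : ℝ) + 1) ∈ Set.Icc (0 : ℝ) 1 :=
    ⟨by positivity, by rw [div_le_one hb]; exact_mod_cast h⟩
  rw [ratUnit, Nat.unpair_pair, Set.projIcc_of_mem _ h']

theorem dist_ratUnit_floor_le (x : unitInterval) (k : ℕ) :
    dist (ratUnit (Nat.pair ⌊(x : ℝ) * 2 ^ k⌋₊ (2 ^ k - 1))) x ≤ (1 / 2 : ℝ) ^ k := by
  have hk : (0 : ℝ) < 2 ^ k := by positivity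
  have h1 : 1 ≤ 2 ^ k := Nat.one_le_two_pow
  have hx : 0 ≤ (x : ℝ) * 2 ^ k := mul_nonneg x.2.1 hk.le
  -- `ratUnit` adds one to the coded denominator, hence `2 ^ k - 1`. Equality occurs at `x = 1`.
  have hle : ⌊(x : ℝ) * 2 ^ k⌋₊ ≤ 2 ^ k - 1 + 1 := by
    rw [Nat.sub_add_cancel h1]
    refine Nat.floor_le_of_le ?_
    push_cast
    nlinarith [x.2.2]
  rw [Subtype.dist_eq, coe_ratUnit_of_le hle, Real.dist_eq, Nat.cast_sub h1]
  push_cast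
  rw [sub_add_cancel, div_pow, one_pow, abs_sub_le_iff]
  have h2 := Nat.floor_le hx
  have h3 := (Nat.lt_floor_add_one ((x : ℝ) * 2 ^ k)).le
  rw [← div_le_iff₀ hk] at h2
  rw [← le_div_iff₀ hk, add_div] at h3
  have h4 : (0 : ℝ) ≤ 1 / 2 ^ k := by positivity
  constructor <;> linarith

/-- Dyadic rounding down is measurable but not continuous; a continuous choice of names on a
connected space would be constant. -/
theorem exists_measurable_name_unitInterval :
    ∃ c : unitInterval → ℕ → ℕ, (∀ n, Measurable fun x => c x n) ∧
      ∀ x, Represented.IsName (c x) x := by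
  -- Precision `n + 1` in place of `n` lets two rounding errors add up to at most `2 ^ (-i)`.
  refine ⟨fun x n => Nat.pair ⌊(x : ℝ) * 2 ^ (n + 1)⌋₊ (2 ^ (n + 1) - 1), fun n => ?_,
    fun x => ⟨fun i k hik => ?_, ?_⟩⟩
  · exact (measurable_of_countable fun a => Nat.pair a (2 ^ (n + 1) - 1)).comp
      (Nat.measurable_floor.comp (measurable_subtype_coe.mul_const _))
  · refine (dist_triangle_right _ _ x).trans ?_
    refine (add_le_add (dist_ratUnit_floor_le x (i + 1)) (dist_ratUnit_floor_le x (k + 1))).trans ?_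
    have : (1 / 2 : ℝ) ^ k ≤ (1 / 2 : ℝ) ^ i :=
      pow_le_pow_of_le_one (by norm_num) (by norm_num) hik.le
    rw [pow_succ, pow_succ]
    linarith
  · rw [tendsto_iff_dist_tendsto_zero]
    refine squeeze_zero (fun _ => dist_nonneg) (fun n => dist_ratUnit_floor_le x (n + 1)) ?_
    exact (tendsto_pow_atTop_nhds_zero_of_lt_one (by norm_num) (by norm_num)).comp
      (Filter.tendsto_add_atTop_nat 1)

theorem dist_ratUnit_le_of_isName {s : ℕ → ℕ} {y : unitInterval} (h : Represented.IsName s y)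
    (i : ℕ) : dist (ratUnit (s i)) y ≤ (1 / 2 : ℝ) ^ i := by
  have hlim : Filter.Tendsto (fun k => dist (ratUnit (s i)) (ratUnit (s k))) Filter.atTop
      (nhds (dist (ratUnit (s i)) y)) := tendsto_const_nhds.dist h.2
  exact le_of_tendsto hlim ((Filter.eventually_gt_atTop i).mono fun k hk => h.1 i k hk)

/-- The `i`-th of `M` equal subintervals, enlarged by `r` on both sides. -/
def slab (M : ℕ) (r : ℝ) (i : Fin M) : Set unitInterval :=
  {y | (y : ℝ) ∈ Set.Ioo ((i : ℝ) / M - r) (((i : ℝ) + 1) / M + r)}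

theorem isOpen_slab (M : ℕ) (r : ℝ) (i : Fin M) : IsOpen (slab M r i) :=
  isOpen_Ioo.preimage continuous_subtype_val

theorem volume_real_slab_le {M : ℕ} {r : ℝ} (hr : 0 ≤ r) (i : Fin M) :
    (volume : Measure unitInterval).real (slab M r i) ≤ 1 / M + 2 * r := by
  have h1 : (volume : Measure unitInterval) (slab M r i) ≤
      volume (Set.Ioo ((i : ℝ) / M - r) (((i : ℝ) + 1) / M + r)) := by
    rw [unitInterval.volume_apply]
    exact measure_mono (Set.image_subset_iff.2 fun y hy => hy)
  rw [Real.volume_Ioo] at h1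
  have h2 := ENNReal.toReal_mono ENNReal.ofReal_ne_top h1
  have e : ((i : ℝ) + 1) / M + r - ((i : ℝ) / M - r) = 1 / M + 2 * r := by ring
  rwa [e, ENNReal.toReal_ofReal (by positivity)] at h2

theorem exists_mem_Icc_div {M : ℕ} (hM : 0 < M) (x : unitInterval) :
    ∃ i : Fin M, (x : ℝ) ∈ Set.Icc ((i : ℝ) / M) (((i : ℝ) + 1) / M) := by
  have hM' : (0 : ℝ) < M := by exact_mod_cast hM
  have hx : 0 ≤ (x : ℝ) * M := mul_nonneg x.2.1 hM'.le
  obtain hlt | hge := lt_or_ge ⌊(x : ℝ) * M⌋₊ M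
  · refine ⟨⟨_, hlt⟩, ?_, ?_⟩
    · rw [div_le_iff₀ hM']
      exact Nat.floor_le hx
    · rw [le_div_iff₀ hM']
      exact (Nat.lt_floor_add_one _).le
  -- Only `x = 1` gets here; it belongs to the last interval.
  · have h1 : (M : ℝ) ≤ (x : ℝ) * M := (Nat.cast_le.2 hge).trans (Nat.floor_le hx)
    have hx1 : (x : ℝ) = 1 := le_antisymm x.2.2 (by nlinarith)
    refine ⟨⟨M - 1, by omega⟩, ?_, ?_⟩
    · simp only [hx1]
      rw [div_le_one hM']
      exact_mod_cast Nat.sub_le M 1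
    · simp only [hx1, Nat.cast_sub hM]
      rw [Nat.cast_one, sub_add_cancel, div_self hM'.ne']

/-- A finite prefix of a Cauchy name cannot decide on which side of an endpoint a point lies, so the
cells are overlapping slabs, and the gap between `ε` and `t / M` pays for the overlap. -/
theorem not_leW_probChoice_unitInterval {ε δ : ℝ} (hε : 0 ≤ ε) (hδ : δ ≤ 1) (h : ε < δ) :
    ¬ LeW (probChoice (volume : Measure unitInterval) (Set.Ioi (ENNReal.ofReal ε)))
      (probChoice (volume : Measure unitInterval) (Set.Ioi (ENNReal.ofReal δ))) := by
  obtain ⟨n, hn⟩ := exists_nat_one_div_lt (sub_pos.2 h)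
  obtain ⟨M, hM0, hM⟩ : ∃ M : ℕ, 0 < M ∧ 1 / (M : ℝ) < δ - ε :=
    ⟨n + 1, by omega, by exact_mod_cast hn⟩
  obtain ⟨t, hεt, htδ⟩ := exists_nat_div_mem_Ioo hε hM hM0
  have htM := le_of_div_lt_of_le_one hM0 htδ hδ
  have hM' : (0 : ℝ) < M := by exact_mod_cast hM0
  -- Enlarging all `M` slabs costs `2 * r * M`, half of the gap.
  obtain ⟨r, hr⟩ : ∃ r : ℝ, r = ((t : ℝ) / M - ε) / (4 * M) := ⟨_, rfl⟩
  have hr0 : 0 < r := hr ▸ div_pos (sub_pos.2 hεt) (by positivity)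
  -- The letter `s N` locates the point within `r`; reading it takes a prefix of length `N + 1`.
  obtain ⟨N, hN⟩ := exists_pow_lt_of_lt_one hr0 (by norm_num : (1 / 2 : ℝ) < 1)
  choose i hi using exists_mem_Icc_div hM0
  refine not_leW_of_hasSmallValues (ι := Fin M) (t := t)
    (hasSmallValues_probChoice volume (U := slab M r) (N := N + 1)
      (j := fun u => i (ratUnit (u.getD N 0))) (isOpen_slab M r) (fun s y hs => ?_)
      (volume_real_slab_le hr0.le) hε (h.trans_le hδ) ?_)
    (hasLargeValues_probChoice volume exists_measurable_name_unitInterval)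
    (by simpa using htM) (by simpa using htδ)
  · have hd := (dist_ratUnit_le_of_isName hs N).trans_lt hN
    have hget : (pre s (N + 1)).getD N 0 = s N := by simp [pre]
    rw [hget]
    obtain ⟨h1, h2⟩ := hi (ratUnit (s N))
    rw [Subtype.dist_eq, Real.dist_eq, abs_lt] at hd
    exact ⟨by linarith, by linarith⟩
  · have e : 1 - ((M : ℝ) - t) * (1 / M + 2 * r) = (t : ℝ) / M - 2 * r * M + 2 * r * t := by
      field_simp
      ring
    have e2 : 2 * r * M = ((t : ℝ) / M - ε) / 2 := by
      rw [hr]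
      field_simp
      ring
    rw [Fintype.card_fin, e, e2]
    have : 0 ≤ 2 * r * t := by positivity
    linarith

/-! ### The equivalences -/

theorem probChoice_tfae {X : Type*} [TopologicalSpace X] [NumberedBasis X]
    [MeasurableSpace X] [Represented X] (μ : Measure X) {ε δ : ℝ}
    (h : ε < δ → ¬ LeW (probChoice μ (Set.Ioi (ENNReal.ofReal ε)))
      (probChoice μ (Set.Ioi (ENNReal.ofReal δ)))) :
    [LeW (probChoice μ (Set.Ioi (ENNReal.ofReal ε))) (probChoice μ (Set.Ioi (ENNReal.ofReal δ))),
      LeSW (probChoice μ (Set.Ioi (ENNReal.ofReal ε)))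
        (probChoice μ (Set.Ioi (ENNReal.ofReal δ))),
      ε ≥ δ].TFAE := by
  tfae_have 1 → 3 := fun h1 => not_lt.1 fun hlt => h hlt h1
  tfae_have 3 → 2 := probChoice_leSW_of_le μ
  tfae_have 2 → 1 := LeSW.leW
  tfae_finish

end Weihrauch

theorem theorem10p1 (ε δ : ℝ) (hε : ε ∈ Set.Icc (0 : ℝ) 1) (hδ : δ ∈ Set.Icc (0 : ℝ) 1) :
    [Weihrauch.LeW
        (Weihrauch.probChoice Weihrauch.cantorMeasure (Set.Ioi (ENNReal.ofReal ε)))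
        (Weihrauch.probChoice Weihrauch.cantorMeasure (Set.Ioi (ENNReal.ofReal δ))),
      Weihrauch.LeSW
        (Weihrauch.probChoice Weihrauch.cantorMeasure (Set.Ioi (ENNReal.ofReal ε)))
        (Weihrauch.probChoice Weihrauch.cantorMeasure (Set.Ioi (ENNReal.ofReal δ))),
      ε ≥ δ].TFAE ∧
    [Weihrauch.LeW
        (Weihrauch.probChoice (MeasureTheory.volume : MeasureTheory.Measure unitInterval)
          (Set.Ioi (ENNReal.ofReal ε)))
        (Weihrauch.probChoice (MeasureTheory.volume : MeasureTheory.Measure unitInterval)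
          (Set.Ioi (ENNReal.ofReal δ))),
      Weihrauch.LeSW
        (Weihrauch.probChoice (MeasureTheory.volume : MeasureTheory.Measure unitInterval)
          (Set.Ioi (ENNReal.ofReal ε)))
        (Weihrauch.probChoice (MeasureTheory.volume : MeasureTheory.Measure unitInterval)
          (Set.Ioi (ENNReal.ofReal δ))),
      ε ≥ δ].TFAE ∧
    (Weihrauch.LeW (Weihrauch.quantWWKL ε) (Weihrauch.quantWWKL δ) ↔ ε ≥ δ) :=
  ⟨Weihrauch.probChoice_tfae _ (Weihrauch.not_leW_probChoice_cantor hε.1 hδ.2),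
    Weihrauch.probChoice_tfae _ (Weihrauch.not_leW_probChoice_unitInterval hε.1 hδ.2),
    fun h => not_lt.1 fun hlt => Weihrauch.not_leW_quantWWKL hε.1 hδ.2 hlt h,
    fun h => (Weihrauch.quantWWKL_leSW_of_le h).leW⟩
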